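/- Let $q\ge 7$ be a prime power and let $\mathrm{PG}(2,q)$ be the Desarguesian projective plane over the field $\mathrm{GF}(q)$. A non-empty set $S$ of points is called a $t$-semiarc if for every point $P\in S$ there are exactly $t$ lines $m$ with $S\cap m=\{P\}$; these lines are the tangents to $S$ at $P$. A $k$-secant of $S$ is a line meeting $S$ in exactly $k$ points. The pencil with carrier $C$ is the set of all lines through the point $C$; a set of lines is said to belong to $n$ pencils if there are $n$ distinct points such that every line of the set passes through at least one of them. Let $t$ be an integer with $1<t<\sqrt q$, let $S$ be a $t$-semiarc in $\mathrm{PG}(2,q)$, and let $\ell$ be a $k$-secant of $S$ with $$k>q-\frac{q}{t}+1 .$$ There are exactly $kt$ lines that are tangent to $S$ at a point of $S\cap\ell$, and the following hold. 1. If $|S|<(q-t+k)+\dfrac{k}{t+1}-1$, then the $kt$ tangents at the points of $S\cap\ell$ belong to $t+1$ pencils. 2. If $|S|<(q-t+k)+\dfrac{k}{t+1}-\dfrac t2$, then the $kt$ tangents at the points of $S\cap\ell$ belong to $t$ pencils. -/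

import Mathlib

open scoped LinearAlgebra.Projectivization

namespace PG2

/-- The points of the Desarguesian projective plane over `F` (this is `PG(2,q)` when `F` is the
field with `q` elements), given by homogeneous coordinates `(x : y : z)`. -/
abbrev Point (F : Type*) [Field F] := ℙ F (Fin 3 → F)

/-- The lines of the projective plane over `F`, given by homogeneous coordinates `[a : b : c]`.
Incidence `P ∈ l` is Mathlib's one (`Configuration.ofField`), namely `a x + b y + c z = 0`. -/
abbrev Line (F : Type*) [Field F] := ℙ F (Fin 3 → F)

variable {F : Type*} [Field F]

/-- The set of points of a line. -/
def Line.points (l : Line F) : Set (Point F) := {P | P ∈ l}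

/-- The line `m` is a tangent to `S` at `P`: it meets `S` exactly in the point `P`. -/
def IsTangentAt (S : Set (Point F)) (P : Point F) (m : Line F) : Prop :=
  S ∩ Line.points m = {P}

/-- A `t`-semiarc: a non-empty point set with exactly `t` tangents at each of its points. -/
def IsSemiarc (t : ℕ) (S : Set (Point F)) : Prop :=
  S.Nonempty ∧ ∀ P ∈ S, {m : Line F | IsTangentAt S P m}.encard = t

/-- A `k`-secant of `S`: a line meeting `S` in exactly `k` points. -/
def IsSecant (k : ℕ) (S : Set (Point F)) (l : Line F) : Prop :=
  (S ∩ Line.points l).encard = k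

/-- The set of all tangents to `S` at the points of `S ∩ l`. -/
def tangentsAlong (S : Set (Point F)) (l : Line F) : Set (Line F) :=
  {m | ∃ P ∈ S ∩ Line.points l, IsTangentAt S P m}

/-- The pencil with carrier `C`: the set of all lines through `C`. -/
def pencil (C : Point F) : Set (Line F) := {m | C ∈ m}

/-- The lines in `L` belong to `n` pencils: there are `n` distinct points such that each line
in `L` lies in the pencil of one of them. -/
def BelongToPencils (n : ℕ) (L : Set (Line F)) : Prop :=
  ∃ Cs : Finset (Point F), Cs.card = n ∧ ∀ m ∈ L, ∃ C ∈ Cs, m ∈ pencil C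

end PG2

/-! Write `n` for the number of points of `S` off `l`. The heart is a Szőnyi–Weiner inequality for
the index `s` of a point `Q` off `l`, the number of tangents along `l` through `Q`: `q s - k t ≤ s
(n + s - k)` (`tangentIndex_quadratic`). Choose `P₀` on `l` outside `S`, and affine coordinates `c`
on `l` and `y` on the line `P₀Q`, both omitting `P₀`. The line joining `c` to `y` misses `S` off `l`
iff a product `f_c(y)` of `n` linear forms in `(c, y)` is nonzero.

The Hankel determinant of the moments `∑ w_c f_c(y) c^(i+j)`, with `w_c` the Lagrange weights, has
degree at most `s (n + s - k)` when it is nonzero; it is divisible by `(y - z)^(s - index z)` for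
every `z`; for `s` the index of `Q` it does not vanish at `Q`. Comparing degrees gives the
inequality.

If `n` is small enough, the quadratic is negative at `t + 1`, so every index is at most `t` or at
least `D = k + q - t - n` (`le_tangentIndex`). The bound on `k` puts a point of index above `t` on
every tangent (`exists_lt_tangentIndex`), and Bonferroni's inequality limits the number of points of
index at least `D` (`belongToPencils_of_index`). -/

open Polynomial

/-- A determinant whose nonzero entries have degree at most `a i + b j` has degree at most
`∑ i, a i + ∑ j, b j`. -/
theorem Matrix.natDegree_det_le_of_weights {R n : Type*} [CommRing R] [Fintype n] [DecidableEq n]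
    (M : Matrix n n R[X]) (a b : n → ℤ)
    (h : ∀ i j, M i j ≠ 0 → ((M i j).natDegree : ℤ) ≤ a i + b j) (hM : M.det ≠ 0) :
    (M.det.natDegree : ℤ) ≤ ∑ i, a i + ∑ j, b j := by
  by_contra! hlt
  apply hM
  rw [← leadingCoeff_eq_zero, leadingCoeff]
  -- Any coefficient above the bound vanishes, so the leading one would too. The weights are
  -- integers because the bound may be negative.
  generalize M.det.natDegree = e at hlt
  rw [Matrix.det_apply, finsetSum_coeff]
  refine Finset.sum_eq_zero fun σ _ => ?_
  rw [coeff_smul]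
  have hzero : (∏ i, M (σ i) i).coeff e = 0 := by
    by_cases h0 : ∃ i, M (σ i) i = 0
    · obtain ⟨i, hi⟩ := h0
      have hprod : ∏ i, M (σ i) i = 0 := Finset.prod_eq_zero (Finset.mem_univ i) hi
      rw [hprod, coeff_zero]
    · push Not at h0
      apply coeff_eq_zero_of_natDegree_lt
      have h1 : (∏ i, M (σ i) i).natDegree ≤ ∑ i, (M (σ i) i).natDegree :=
        natDegree_prod_le _ _
      have h2 : ((∑ i, (M (σ i) i).natDegree : ℕ) : ℤ) ≤ ∑ i, (a (σ i) + b i) := by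
        rw [Nat.cast_sum]
        exact Finset.sum_le_sum fun i _ => h _ _ (h0 i)
      rw [Finset.sum_add_distrib, Equiv.sum_comp σ a] at h2
      omega
  rw [hzero, smul_zero]

/-! ### Hankel determinants for products of linear forms -/

namespace LinearForms

variable {F ι : Type*} [Field F]

/-- The product of the linear forms `γ u x + β u y + α u`, as a polynomial in `y` over `F[x]`. -/
noncomputable def bivariate (U : Finset ι) (α β γ : ι → F) : F[X][X] :=
  ∏ u ∈ U, (C (C (β u)) * X + C (C (γ u) * X + C (α u)))

/-- The product of the linear forms `γ u c + β u y + α u`, as a polynomial in `y`. -/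
noncomputable def univariate (U : Finset ι) (α β γ : ι → F) (c : F) : F[X] :=
  ∏ u ∈ U, (C (β u) * X + C (γ u * c + α u))

theorem coeff_coeff_bivariate (U : Finset ι) (α β γ : ι → F) (d e : ℕ) (h : U.card < d + e) :
    ((bivariate U α β γ).coeff d).coeff e = 0 := by
  classical
  induction U using Finset.induction_on generalizing d e with
  | empty =>
    rw [Finset.card_empty] at h
    rw [bivariate, Finset.prod_empty, coeff_one]
    split_ifs with h0
    · rw [coeff_one, if_neg (by omega)]
    · simp
  | insert u U hu ih =>
    rw [Finset.card_insert_of_notMem hu] at h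
    have key : bivariate (insert u U) α β γ =
        C (C (β u)) * (X * bivariate U α β γ)
          + C (C (γ u) * X + C (α u)) * bivariate U α β γ := by
      rw [bivariate, Finset.prod_insert hu, ← bivariate]
      ring
    have hx : ((X * bivariate U α β γ).coeff d).coeff e = 0 := by
      cases d with
      | zero => simp
      | succ d => rw [coeff_X_mul]; exact ih _ _ (by omega)
    have hy : (X * (bivariate U α β γ).coeff d).coeff e = 0 := by
      cases e with
      | zero => simp
      | succ e => rw [coeff_X_mul]; exact ih _ _ (by omega)
    rw [key, coeff_add, coeff_C_mul, coeff_C_mul, coeff_add, coeff_C_mul, hx, add_mul, coeff_add,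
      mul_assoc, coeff_C_mul, hy, coeff_C_mul, ih _ _ (by omega)]
    simp

theorem coeff_univariate (U : Finset ι) (α β γ : ι → F) (c : F) (d : ℕ) :
    (univariate U α β γ c).coeff d = ((bivariate U α β γ).coeff d).eval c := by
  have : univariate U α β γ c = (bivariate U α β γ).map (evalRingHom c) := by
    simp [univariate, bivariate, Polynomial.map_prod]
  rw [this, coeff_map, coe_evalRingHom]

theorem eval_univariate (U : Finset ι) (α β γ : ι → F) (c y : F) :
    (univariate U α β γ c).eval y = ∏ u ∈ U, (γ u * c + β u * y + α u) := by
  rw [univariate, eval_prod]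
  refine Finset.prod_congr rfl fun u _ => ?_
  simp only [eval_add, eval_mul, eval_C, eval_X]
  ring

variable [DecidableEq F]

/-- The inverse of the derivative at `c` of the polynomial with simple roots `K`. -/
noncomputable def weight (K : Finset F) (c : F) : F := (∏ d ∈ K.erase c, (c - d))⁻¹

theorem weight_ne_zero (K : Finset F) (c : F) : weight K c ≠ 0 := by
  refine inv_ne_zero (Finset.prod_ne_zero_iff.mpr fun d hd => ?_)
  exact sub_ne_zero.mpr (Finset.ne_of_mem_erase hd).symm

/-- By Lagrange interpolation the sum is the coefficient of `p` in degree `K.card - 1`. -/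
theorem sum_weight_mul_eval (K : Finset F) (p : F[X]) (hp : ∀ e, K.card ≤ e + 1 → p.coeff e = 0) :
    ∑ c ∈ K, weight K c * p.eval c = 0 := by
  rcases K.eq_empty_or_nonempty with rfl | hK
  · simp
  have hpos := hK.card_pos
  have hdeg : p.degree < K.card := by
    rw [degree_lt_iff_coeff_zero]
    exact fun e he => hp e (by omega)
  have := Lagrange.coeff_eq_sum (s := K) (v := id) (Set.injOn_id _) hdeg
  rw [hp _ (by omega)] at this
  rw [this]
  refine Finset.sum_congr rfl fun c _ => ?_
  simp [weight, div_eq_inv_mul]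

/-- The Hankel matrix of the weighted moments of the values of a product of linear forms. -/
noncomputable def hankel (K : Finset F) (U : Finset ι) (α β γ : ι → F) (s : ℕ) :
    Matrix (Fin s) (Fin s) F[X] :=
  Matrix.of fun i j =>
    ∑ c ∈ K, (C (weight K c) * univariate U α β γ c * C c ^ (i : ℕ)) * C c ^ (j : ℕ)

/-- The coefficient of `y^d` is the weighted sum of the values of a polynomial in `c` of degree at
most `U.card - d + i + j`; it vanishes once this is below `K.card - 1`. -/
theorem natDegree_hankel_le (K : Finset F) (U : Finset ι) (α β γ : ι → F) (s : ℕ) (i j : Fin s)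
    (h : hankel K U α β γ s i j ≠ 0) :
    ((hankel K U α β γ s i j).natDegree : ℤ) ≤ (U.card + i + 1 - K.card) + j := by
  by_contra! hlt
  apply h
  rw [← leadingCoeff_eq_zero, leadingCoeff]
  generalize (hankel K U α β γ s i j).natDegree = d at hlt
  rw [hankel, Matrix.of_apply, finsetSum_coeff]
  rw [← sum_weight_mul_eval K (X ^ (i + j : ℕ) * (bivariate U α β γ).coeff d)]
  · refine Finset.sum_congr rfl fun c _ => ?_
    rw [← C_pow, ← C_pow, coeff_mul_C, coeff_mul_C, coeff_C_mul, coeff_univariate, eval_mul,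
      eval_pow, eval_X, pow_add]
    ring
  · intro e he
    rw [coeff_X_pow_mul']
    split_ifs with hle
    · exact coeff_coeff_bivariate _ _ _ _ _ _ (by omega)
    · rfl

theorem natDegree_det_hankel_le (K : Finset F) (U : Finset ι) (α β γ : ι → F) (s : ℕ)
    (h : (hankel K U α β γ s).det ≠ 0) :
    ((hankel K U α β γ s).det.natDegree : ℤ) ≤ s * (U.card + s - K.card) := by
  refine (Matrix.natDegree_det_le_of_weights _ (fun i : Fin s => U.card + i + 1 - K.card)
    (fun j : Fin s => j)
    (natDegree_hankel_le K U α β γ s) h).trans (le_of_eq ?_)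
  have hs : ∀ m : ℕ, (∑ i : Fin m, ((U.card : ℤ) + i + 1 - K.card)) + ∑ j : Fin m, (j : ℤ)
      = m * (U.card + m - K.card) := by
    intro m
    induction m with
    | zero => simp
    | succ m ih =>
      rw [Fin.sum_univ_castSucc, Fin.sum_univ_castSucc]
      simp only [Fin.val_castSucc, Fin.val_last]
      push_cast
      linarith
  exact hs s

/-- Each row is a sum over `K` of multiples of the rows `(c^j)`, so multilinearity in the rows
yields Vandermonde determinants. -/
theorem det_hankel_eq_sum (K : Finset F) (U : Finset ι) (α β γ : ι → F) (s : ℕ) :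
    (hankel K U α β γ s).det = ∑ r ∈ Fintype.piFinset fun _ : Fin s => K,
      (∏ i, C (weight K (r i)) * univariate U α β γ (r i) * C (r i) ^ (i : ℕ)) *
        (Matrix.vandermonde fun i => C (r i)).det := by
  have h : hankel K U α β γ s = fun i : Fin s => ∑ c ∈ K,
      (C (weight K c) * univariate U α β γ c * C c ^ (i : ℕ)) • fun j : Fin s => C c ^ (j : ℕ) := by
    funext i j
    rw [Finset.sum_apply]
    rfl
  rw [h]
  refine (Matrix.detRowAlternating.toMultilinearMap.map_sum_finset
    (fun (i : Fin s) c => (C (weight K c) * univariate U α β γ c * C c ^ (i : ℕ)) •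
      fun j : Fin s => C c ^ (j : ℕ)) fun _ => K).trans ?_
  refine Finset.sum_congr rfl fun r _ => ?_
  rw [MultilinearMap.map_smul_univ, smul_eq_mul]
  rfl

variable {K : Finset F} {U : Finset ι} {α β γ : ι → F}

/-- The number of `c ∈ K` for which no linear form vanishes at `(c, y)`. -/
noncomputable def index (K : Finset F) (U : Finset ι) (α β γ : ι → F) (y : F) : ℕ :=
  (K.filter fun c => ∀ u ∈ U, γ u * c + β u * y + α u ≠ 0).card

theorem index_eq_ncard (y : F) :
    index K U α β γ y = {c | c ∈ K ∧ ∀ u ∈ U, γ u * c + β u * y + α u ≠ 0}.ncard := by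
  rw [index, ← Set.ncard_coe_finset, Finset.coe_filter]

theorem sum_index_le [Fintype F] {t : ℕ}
    (h : ∀ c ∈ K, {y | ∀ u ∈ U, γ u * c + β u * y + α u ≠ 0}.ncard ≤ t) :
    ∑ y, index K U α β γ y ≤ K.card * t := by
  simp only [index, Finset.card_filter]
  rw [Finset.sum_comm, ← smul_eq_mul]
  refine Finset.sum_le_card_nsmul _ _ _ fun c hc => ?_
  rw [← Finset.card_filter, ← Set.ncard_coe_finset, Finset.coe_filter_univ]
  exact h c hc

/-- Only injective `r` survive in the expansion, and then at most `index y` of the `s` factors are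
nonzero at `y`; each of the others contributes a factor `X - C y`. -/
theorem X_sub_C_pow_dvd_det_hankel (s : ℕ) (y : F) :
    (X - C y) ^ (s - index K U α β γ y) ∣ (hankel K U α β γ s).det := by
  rw [det_hankel_eq_sum]
  refine Finset.dvd_sum fun r hr => ?_
  rw [Fintype.mem_piFinset] at hr
  by_cases hinj : Function.Injective r
  swap
  · rw [Matrix.det_vandermonde_eq_zero_iff.mpr, mul_zero]
    · exact dvd_zero _
    · simp only [Function.Injective, not_forall] at hinj
      obtain ⟨i, j, hij, hne⟩ := hinj
      exact ⟨i, j, by rw [hij], hne⟩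
  refine Dvd.dvd.mul_right ?_ _
  let Z : Finset (Fin s) := Finset.univ.filter fun i => (univariate U α β γ (r i)).eval y = 0
  have hZ : s - index K U α β γ y ≤ Z.card := by
    have h1 : Z.card + (Finset.univ.filter fun i =>
        ¬ (univariate U α β γ (r i)).eval y = 0).card = s := by
      simpa using Finset.card_filter_add_card_filter_not (s := (Finset.univ : Finset (Fin s)))
        (fun i => (univariate U α β γ (r i)).eval y = 0)
    have h2 : (Finset.univ.filter fun i =>
        ¬ (univariate U α β γ (r i)).eval y = 0).card ≤ index K U α β γ y := by
      refine Finset.card_le_card_of_injOn r (fun i hi => ?_) hinj.injOn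
      simp only [Finset.coe_filter, Finset.mem_univ, true_and, Set.mem_ofPred_eq, eval_univariate,
        Finset.prod_eq_zero_iff, not_exists, not_and] at hi ⊢
      exact ⟨hr i, hi⟩
    omega
  calc (X - C y) ^ (s - index K U α β γ y) ∣ (X - C y) ^ Z.card := pow_dvd_pow _ hZ
    _ = ∏ i ∈ Z, (X - C y) := (Finset.prod_const _).symm
    _ ∣ ∏ i ∈ Z, C (weight K (r i)) * univariate U α β γ (r i) * C (r i) ^ (i : ℕ) := by
      refine Finset.prod_dvd_prod_of_dvd _ _ fun i hi => ?_
      refine Dvd.dvd.mul_right (Dvd.dvd.mul_left ?_ _) _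
      exact dvd_iff_isRoot.mpr (Finset.mem_filter.mp hi).2
    _ ∣ _ := Finset.prod_dvd_prod_of_subset _ _ _ (Finset.subset_univ _)

/-- At `y` only the `c` counted by the index survive, so the matrix becomes `Vᵀ D V` with `V` a
square Vandermonde matrix and `D` an invertible diagonal one. -/
theorem det_hankel_ne_zero (y : F) : (hankel K U α β γ (index K U α β γ y)).det ≠ 0 := by
  intro h0
  have h := congrArg (eval y) h0
  rw [← coe_evalRingHom, RingHom.map_det, map_zero] at h
  let Z := K.filter fun c => ∀ u ∈ U, γ u * c + β u * y + α u ≠ 0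
  let e : Fin (index K U α β γ y) ≃ Z := Z.equivFin.symm
  let a : Fin (index K U α β γ y) → F := fun m =>
    weight K (e m) * (univariate U α β γ (e m : F)).eval y
  let V := Matrix.vandermonde fun m => (e m : F)
  have hV : V.det ≠ 0 :=
    Matrix.det_vandermonde_ne_zero_iff.mpr (Subtype.val_injective.comp e.injective)
  have ha : (Matrix.diagonal a).det ≠ 0 := by
    rw [Matrix.det_diagonal]
    refine Finset.prod_ne_zero_iff.mpr fun m _ => mul_ne_zero (weight_ne_zero _ _) ?_
    rw [eval_univariate]
    exact Finset.prod_ne_zero_iff.mpr (Finset.mem_filter.mp (e m).2).2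
  have hmat : (evalRingHom y).mapMatrix (hankel K U α β γ (index K U α β γ y)) =
      V.transpose * Matrix.diagonal a * V := by
    ext i j
    rw [Matrix.mul_apply]
    simp only [Matrix.mul_diagonal, RingHom.mapMatrix_apply, Matrix.map_apply, hankel,
      Matrix.of_apply, coe_evalRingHom, eval_finsetSum, eval_mul, eval_pow, eval_C, V,
      Matrix.transpose_apply, Matrix.vandermonde_apply]
    rw [← Finset.sum_filter_add_sum_filter_not K
      (fun c => ∀ u ∈ U, γ u * c + β u * y + α u ≠ 0)]
    rw [Finset.sum_eq_zero (s := K.filter fun c => ¬ ∀ u ∈ U, γ u * c + β u * y + α u ≠ 0),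
      add_zero, ← Finset.sum_coe_sort, ← e.sum_comp]
    · refine Finset.sum_congr rfl fun m _ => ?_
      simp only [a]
      ring
    · intro c hc
      have hc' := (Finset.mem_filter.mp hc).2
      push Not at hc'
      rw [eval_univariate, Finset.prod_eq_zero_iff.mpr hc']
      simp
  rw [hmat, Matrix.det_mul, Matrix.det_mul, Matrix.det_transpose] at h
  exact mul_ne_zero (mul_ne_zero hV ha) hV h

/-- The lemma of Szőnyi and Weiner on the degrees of greatest common divisors, for a product of
linear forms and a polynomial in one variable with simple roots. -/
theorem card_mul_index_sub_sum_index_le [Fintype F] (y : F) :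
    (Fintype.card F : ℤ) * index K U α β γ y - ∑ z, (index K U α β γ z : ℤ) ≤
      index K U α β γ y * (U.card + index K U α β γ y - K.card) := by
  set s := index K U α β γ y with hs
  have hne : (hankel K U α β γ s).det ≠ 0 := det_hankel_ne_zero y
  have hdvd : ∏ z : F, (X - C z) ^ (s - index K U α β γ z) ∣ (hankel K U α β γ s).det := by
    refine Finset.prod_dvd_of_coprime (fun a _ b _ hab => ?_)
      fun z _ => X_sub_C_pow_dvd_det_hankel s z
    exact (pairwise_coprime_X_sub_C Function.injective_id hab).pow
  have hdeg := natDegree_le_of_dvd hdvd hne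
  rw [natDegree_prod_of_monic _ _ fun z _ => (monic_X_sub_C z).pow _] at hdeg
  simp only [natDegree_pow, natDegree_X_sub_C, mul_one] at hdeg
  have h1 : (Fintype.card F : ℤ) * s - ∑ z, (index K U α β γ z : ℤ) =
      ∑ z, ((s : ℤ) - index K U α β γ z) := by
    rw [Finset.sum_sub_distrib, Finset.sum_const, Finset.card_univ, nsmul_eq_mul]
  -- Truncated subtraction replaces negative terms by `0`, which only increases the sum.
  have h2 : ∑ z, ((s : ℤ) - index K U α β γ z) ≤
      ((∑ z, (s - index K U α β γ z) : ℕ) : ℤ) := by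
    rw [Nat.cast_sum]
    exact Finset.sum_le_sum fun z _ => by omega
  have h3 := natDegree_det_hankel_le K U α β γ s hne
  have h4 : ((∑ z, (s - index K U α β γ z) : ℕ) : ℤ) ≤ (hankel K U α β γ s).det.natDegree := by
    exact_mod_cast hdeg
  linarith

end LinearForms

/-! ### Affine coordinates on lines of the plane -/

namespace PG2

open Projectivization Configuration Matrix

section Coordinates

variable {F : Type*} [Field F]

theorem line_unique {P Q : Point F} {l m : Line F} (hPQ : P ≠ Q) (hPl : P ∈ l) (hQl : Q ∈ l)
    (hPm : P ∈ m) (hQm : Q ∈ m) : l = m :=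
  (Nondegenerate.eq_or_eq hPl hQl hPm hQm).resolve_left hPQ

theorem add_smul_ne_zero {p v : Fin 3 → F} (h : crossProduct p v ≠ 0) (y : F) :
    v + y • p ≠ 0 := by
  intro h0
  apply h
  rw [eq_neg_of_add_eq_zero_left h0, map_neg, map_smul, _root_.cross_self, smul_zero, neg_zero]

/-- The point `v + y p` on the line joining the points `p` and `v`. -/
def along {p v : Fin 3 → F} (h : crossProduct p v ≠ 0) (y : F) : Point F :=
  mk F (v + y • p) (add_smul_ne_zero h y)

variable {p v : Fin 3 → F} (h : crossProduct p v ≠ 0)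

theorem along_injective : Function.Injective (along h) := by
  intro y z hyz
  rw [along, along, mk_eq_mk_iff_crossProduct_eq_zero] at hyz
  have : crossProduct (v + y • p) (v + z • p) = (y - z) • crossProduct p v := by
    simp only [map_add, map_smul, LinearMap.add_apply, LinearMap.smul_apply, _root_.cross_self]
    rw [← cross_anticomm p v]
    module
  rw [this, smul_eq_zero] at hyz
  exact sub_eq_zero.mp (hyz.resolve_right h)

theorem along_ne (hp : p ≠ 0) (y : F) : along h y ≠ mk F p hp := by
  rw [ne_comm, Ne, along, mk_eq_mk_iff_crossProduct_eq_zero, map_add, map_smul, _root_.cross_self,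
    smul_zero, add_zero]
  exact h

theorem along_zero (hv : v ≠ 0) : along h 0 = mk F v hv := by
  simp only [along, zero_smul, add_zero]

theorem along_mem {m : Line F} (hp : p ≠ 0) (hv : v ≠ 0) (hpm : mk F p hp ∈ m)
    (hvm : mk F v hv ∈ m) (y : F) : along h y ∈ m := by
  induction m using Projectivization.ind with | h w hw =>
  rw [ofField.mem_iff, orthogonal_mk] at hpm hvm
  rw [along, ofField.mem_iff, orthogonal_mk, add_dotProduct, smul_dotProduct, hpm, hvm, smul_zero,
    add_zero]

end Coordinates

section Finite

variable {F : Type*} [Field F] [Finite F]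

instance : Finite (Point F) := Projectivization.finite_of_finite F _

theorem order_eq [DecidableEq F] :
    ProjectivePlane.order (Point F) (Line F) = Nat.card F := by
  have h1 := Projectivization.card_of_finrank F (Fin 3 → F) (n := 3) (by simp)
  have := Fintype.ofFinite (Point F)
  have h2 := ProjectivePlane.card_points (Point F) (Line F)
  rw [← Nat.card_eq_fintype_card, h1] at h2
  simp only [Finset.sum_range_succ, Finset.sum_range_zero, pow_zero, pow_one] at h2
  nlinarith

theorem ncard_points (m : Line F) : (Line.points m).ncard = Nat.card F + 1 := by
  classical
  rw [← order_eq]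
  exact ProjectivePlane.pointCount_eq (Point F) m

theorem ncard_pencil (P : Point F) : (pencil P).ncard = Nat.card F + 1 := by
  classical
  rw [← order_eq]
  exact ProjectivePlane.lineCount_eq (Line F) P

theorem exists_along_eq {p v : Fin 3 → F} (h : crossProduct p v ≠ 0) {m : Line F} (hp : p ≠ 0)
    (hv : v ≠ 0) (hpm : mk F p hp ∈ m) (hvm : mk F v hv ∈ m) {R : Point F} (hR : R ∈ m)
    (hRp : R ≠ mk F p hp) : ∃ y, along h y = R := by
  have hsub : Set.range (along h) ⊆ Line.points m \ {mk F p hp} := by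
    rintro _ ⟨y, rfl⟩
    exact ⟨along_mem h hp hv hpm hvm y, along_ne h hp y⟩
  have hcard : (Line.points m \ {mk F p hp}).ncard ≤ (Set.range (along h)).ncard := by
    rw [Set.ncard_sdiff_singleton_of_mem (show mk F p hp ∈ Line.points m from hpm), ncard_points,
      ← Set.image_univ, Set.ncard_image_of_injective _ (along_injective h), Set.ncard_univ]
    omega
  have heq := Set.eq_of_subset_of_ncard_le hsub hcard (Set.toFinite _)
  have : R ∈ Set.range (along h) := heq ▸ ⟨hR, hRp⟩
  exact this

end Finite

end PG2

/-! ### Tangents and the quadratic inequality -/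

namespace PG2

open Projectivization Configuration Matrix

section Tangents

variable {F : Type*} [Field F] {S : Set (Point F)} {l : Line F}

theorem isTangentAt_iff {P : Point F} {m : Line F} (hPS : P ∈ S) (hPl : P ∈ l) (hPm : P ∈ m)
    (hml : m ≠ l) : IsTangentAt S P m ↔ ∀ u ∈ S \ Line.points l, u ∉ m := by
  constructor
  · rintro h u ⟨huS, hul⟩ hum
    have : u ∈ S ∩ Line.points m := ⟨huS, hum⟩
    rw [h, Set.mem_singleton_iff] at this
    exact hul (this ▸ hPl)
  · intro h
    refine Set.eq_singleton_iff_unique_mem.mpr ⟨⟨hPS, hPm⟩, ?_⟩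
    rintro u ⟨huS, hum⟩
    by_contra hne
    have hul : u ∈ l := by
      by_contra hul
      exact h u ⟨huS, hul⟩ hum
    exact hml (line_unique hne hum hPm hul hPl)

theorem IsTangentAt.mem {P : Point F} {m : Line F} (h : IsTangentAt S P m) : P ∈ S ∧ P ∈ m := by
  have : P ∈ S ∩ Line.points m := by rw [h]; rfl
  exact this

theorem IsTangentAt.eq {P Q : Point F} {m : Line F} (h : IsTangentAt S P m) (hQS : Q ∈ S)
    (hQm : Q ∈ m) : Q = P := by
  have : Q ∈ S ∩ Line.points m := ⟨hQS, hQm⟩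
  rwa [h] at this

/-- A line with at least two points in `S` is not a tangent. -/
theorem not_isTangentAt (hl : 2 ≤ (S ∩ Line.points l).ncard) (P : Point F) :
    ¬ IsTangentAt S P l := by
  intro h
  rw [h, Set.ncard_singleton] at hl
  omega

/-- The number of tangents at the points of `S ∩ l` that pass through `Q`. -/
noncomputable def tangentIndex (S : Set (Point F)) (l : Line F) (Q : Point F) : ℕ :=
  (tangentsAlong S l ∩ pencil Q).ncard

/-- The `c y` term vanishes because `p × p = 0`. This is why both coordinates omit the same point
`p`: incidence becomes affine linear in `(c, y)`. -/
theorem dotProduct_crossProduct_add_smul (u a p v : Fin 3 → F) (c y : F) :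
    u ⬝ᵥ crossProduct (a + c • p) (v + y • p) =
      (u ⬝ᵥ crossProduct p v) * c + (u ⬝ᵥ crossProduct a p) * y + u ⬝ᵥ crossProduct a v := by
  simp only [map_add, map_smul, LinearMap.add_apply, LinearMap.smul_apply, _root_.cross_self,
    dotProduct_add, dotProduct_smul, smul_eq_mul, smul_zero, dotProduct_zero]
  ring

/-- The numbers of tangents through the points of a line that meets `l` outside `S`
satisfy a quadratic inequality. -/
theorem tangentIndex_quadratic [Finite F] {t : ℕ}
    (hl : 2 ≤ (S ∩ Line.points l).ncard)
    (ht : ∀ P ∈ S ∩ Line.points l, {m : Line F | IsTangentAt S P m}.ncard ≤ t)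
    {P₀ Q₀ : Point F} (hP₀l : P₀ ∈ l) (hP₀S : P₀ ∉ S) (hQ₀ : Q₀ ∉ l) :
    (Nat.card F : ℤ) * tangentIndex S l Q₀ - (S ∩ Line.points l).ncard * t ≤
      tangentIndex S l Q₀ *
        ((S \ Line.points l).ncard + tangentIndex S l Q₀ - (S ∩ Line.points l).ncard) := by
  classical
  have := Fintype.ofFinite F
  have := Fintype.ofFinite (Point F)
  obtain ⟨A, hAS, hAl⟩ : (S ∩ Line.points l).Nonempty := by
    rw [← Set.ncard_pos]
    omega
  have hAP₀ : P₀ ≠ A := fun h => hP₀S (h ▸ hAS)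
  have hQP₀ : P₀ ≠ Q₀ := fun h => hQ₀ (h ▸ hP₀l)
  induction P₀ using Projectivization.ind with | h p hp =>
  induction Q₀ using Projectivization.ind with | h v hv =>
  induction A using Projectivization.ind with | h a ha =>
  have hpa : crossProduct p a ≠ 0 := mt (mk_eq_mk_iff_crossProduct_eq_zero hp ha).mpr hAP₀
  have hpv : crossProduct p v ≠ 0 := mt (mk_eq_mk_iff_crossProduct_eq_zero hp hv).mpr hQP₀
  let M : Line F := mk F (crossProduct p v) hpv
  have hpM : mk F p hp ∈ M := dot_self_cross p v
  have hvM : mk F v hv ∈ M := dot_cross_self p v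
  have hMl : M ≠ l := fun h => hQ₀ (h ▸ hvM)
  have hxl : ∀ c, along hpa c ∈ l := along_mem hpa hp ha hP₀l hAl
  have hyM : ∀ y, along hpv y ∈ M := along_mem hpv hp hv hpM hvM
  have hyl : ∀ y, along hpv y ∉ l := fun y h =>
    hMl (line_unique (along_ne hpv hp y) (hyM y) hpM h hP₀l)
  have hxM : ∀ c, along hpa c ∉ M := fun c h =>
    hMl (line_unique (along_ne hpa hp c) h hpM (hxl c) hP₀l)
  have hxy : ∀ c y, along hpa c ≠ along hpv y := fun c y h => hyl y (h ▸ hxl c)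
  have hne : ∀ c y, crossProduct (a + c • p) (v + y • p) ≠ 0 := fun c y =>
    mt (mk_eq_mk_iff_crossProduct_eq_zero (add_smul_ne_zero hpa c)
      (add_smul_ne_zero hpv y)).mpr (hxy c y)
  let L : F → F → Line F := fun c y => mk F _ (hne c y)
  have hxL : ∀ c y, along hpa c ∈ L c y := fun c y => dot_self_cross _ _
  have hyL : ∀ c y, along hpv y ∈ L c y := fun c y => dot_cross_self _ _
  have hLl : ∀ c y, L c y ≠ l := fun c y h => hyl y (h ▸ hyL c y)
  let K : Finset F := Finset.univ.filter fun c => along hpa c ∈ S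
  let U : Finset (Point F) := (S \ Line.points l).toFinset
  let α : Point F → F := fun u => u.rep ⬝ᵥ crossProduct a v
  let β : Point F → F := fun u => u.rep ⬝ᵥ crossProduct a p
  let γ : Point F → F := fun u => u.rep ⬝ᵥ crossProduct p v
  have hK : K.card = (S ∩ Line.points l).ncard := by
    have himg : S ∩ Line.points l = along hpa '' (K : Set F) := by
      ext R
      constructor
      · rintro ⟨hRS, hRl⟩
        obtain ⟨c, rfl⟩ := exists_along_eq hpa hp ha hP₀l hAl hRl fun h => hP₀S (h ▸ hRS)
        exact ⟨c, by simpa [K] using hRS, rfl⟩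
      · rintro ⟨c, hc, rfl⟩
        exact ⟨by simpa [K] using hc, hxl c⟩
    rw [himg, Set.ncard_image_of_injective _ (along_injective hpa), Set.ncard_coe_finset]
  have hU : U.card = (S \ Line.points l).ncard := (Set.ncard_eq_toFinset_card' _).symm
  have hmem : ∀ (u : Point F) (c y : F), u ∈ L c y ↔ γ u * c + β u * y + α u = 0 := by
    intro u c y
    rw [← dotProduct_crossProduct_add_smul]
    conv_lhs => rw [← u.mk_rep]
    rfl
  have htan : ∀ c y, c ∈ K →
      ((∀ u ∈ U, γ u * c + β u * y + α u ≠ 0) ↔ IsTangentAt S (along hpa c) (L c y)) := by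
    intro c y hc
    rw [isTangentAt_iff (Finset.mem_filter.mp hc).2 (hxl c) (hxL c y) (hLl c y)]
    simp only [U, Set.mem_toFinset, hmem, Ne]
  have hindex : LinearForms.index K U α β γ 0 = tangentIndex S l (mk F v hv) := by
    rw [LinearForms.index_eq_ncard, tangentIndex]
    have himg : tangentsAlong S l ∩ pencil (mk F v hv) = (fun c => L c 0) ''
        {c | c ∈ K ∧ ∀ u ∈ U, γ u * c + β u * 0 + α u ≠ 0} := by
      ext m
      constructor
      · rintro ⟨⟨P, ⟨hPS, hPl⟩, hm⟩, hvm⟩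
        obtain ⟨c, rfl⟩ := exists_along_eq hpa hp ha hP₀l hAl hPl fun h => hP₀S (h ▸ hPS)
        have hcK : c ∈ K := by simpa [K] using hPS
        have hv0 : along hpv 0 ∈ m := by
          rw [along_zero hpv hv]
          exact hvm
        have hL : L c 0 = m := line_unique (hxy c 0) (hxL c 0) (hyL c 0) hm.mem.2 hv0
        refine ⟨c, ?_, hL⟩
        rw [Set.mem_ofPred_eq, htan c 0 hcK, hL]
        exact ⟨hcK, hm⟩
      · rintro ⟨c, hc, rfl⟩
        have hm := (htan c 0 hc.1).mp hc.2
        refine ⟨⟨along hpa c, ⟨hm.mem.1, hxl c⟩, hm⟩, ?_⟩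
        have := hyL c 0
        rw [along_zero hpv hv] at this
        exact this
    rw [himg, Set.ncard_image_of_injective]
    intro c d hcd
    by_contra hne
    have hd : along hpa d ∈ L c 0 := by
      rw [show L c 0 = L d 0 from hcd]
      exact hxL d 0
    exact hLl c 0 (line_unique ((along_injective hpa).ne hne) (hxL c 0) hd (hxl c) (hxl d))
  -- For fixed `c`, different `y` give different lines through `along hpa c`, of which at most `t`
  -- are tangents.
  have hsum : ∑ y, LinearForms.index K U α β γ y ≤ K.card * t := by
    refine LinearForms.sum_index_le fun c hc => ?_
    refine le_trans ?_ (ht (along hpa c) ⟨(Finset.mem_filter.mp hc).2, hxl c⟩)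
    refine Set.ncard_le_ncard_of_injOn (L c) (fun y hy => ?_) (fun y _ z _ hyz => ?_)
    · exact (htan c y hc).mp hy
    · by_contra hne
      have hz : along hpv z ∈ L c y := by
        rw [hyz]
        exact hyL c z
      have hLM : L c y = M :=
        line_unique ((along_injective hpv).ne hne) (hyL c y) hz (hyM y) (hyM z)
      exact hxM c (hLM ▸ hxL c y)
  have hmain := LinearForms.card_mul_index_sub_sum_index_le (K := K) (U := U) (α := α) (β := β)
    (γ := γ) 0
  rw [hindex, hU, hK, ← Nat.card_eq_fintype_card] at hmain
  have hsum' : ∑ y, (LinearForms.index K U α β γ y : ℤ) ≤ (S ∩ Line.points l).ncard * t := by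
    rw [← hK]
    exact_mod_cast hsum
  linarith

end Tangents

end PG2

/-! ### Counting tangents and pencils -/

namespace PG2

section Counting

variable {F : Type*} [Field F] [Finite F] {S : Set (Point F)} {l : Line F} {t : ℕ}

theorem ncard_tangentsAlong
    (ht : ∀ P ∈ S ∩ Line.points l, {m : Line F | IsTangentAt S P m}.ncard = t) :
    (tangentsAlong S l).ncard = (S ∩ Line.points l).ncard * t := by
  classical
  have := Fintype.ofFinite (Point F)
  have hT : tangentsAlong S l = ((S ∩ Line.points l).toFinset.biUnion fun P =>
      {m : Line F | IsTangentAt S P m}.toFinset : Finset (Line F)) := by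
    ext m
    simp only [Finset.coe_biUnion, Set.coe_toFinset, Set.mem_iUnion]
    exact ⟨fun ⟨P, hP, hm⟩ => ⟨P, hP, hm⟩, fun ⟨P, hP, hm⟩ => ⟨P, hP, hm⟩⟩
  rw [hT, Set.ncard_coe_finset, Finset.card_biUnion, Set.ncard_eq_toFinset_card' (S ∩ _),
    ← smul_eq_mul]
  · refine Finset.sum_const_nat fun P hP => ?_
    rw [← Set.ncard_eq_toFinset_card']
    exact ht P (Set.mem_toFinset.mp hP)
  · intro P _ Q _ hPQ
    refine Finset.disjoint_left.mpr ?_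
    intro m hmP hmQ
    rw [Set.mem_toFinset] at hmP hmQ
    exact hPQ (IsTangentAt.eq hmQ hmP.mem.1 hmP.mem.2)

/-- A long secant of a semiarc has a point outside the semiarc. -/
theorem exists_mem_notMem (h0 : 0 < t) (htq : t < Nat.card F)
    (hl : 2 ≤ (S ∩ Line.points l).ncard)
    (ht : ∀ P ∈ S, {m : Line F | IsTangentAt S P m}.ncard = t) : ∃ P, P ∈ l ∧ P ∉ S := by
  classical
  obtain ⟨A, hAS, hAl⟩ : (S ∩ Line.points l).Nonempty := by
    rw [← Set.ncard_pos]
    omega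
  obtain ⟨u, huS, hul⟩ : (S \ Line.points l).Nonempty := by
    -- If `S` lay on `l`, all `q > t` other lines through `A` would be tangents.
    by_contra! hempty
    have hsub : pencil A \ {l} ⊆ {m : Line F | IsTangentAt S A m} := by
      rintro m ⟨hAm, hml⟩
      refine (isTangentAt_iff hAS hAl hAm hml).mpr fun u hu => ?_
      rw [hempty] at hu
      exact hu.elim
    have hcard := Set.ncard_le_ncard hsub
    rw [ht A hAS, Set.ncard_sdiff_singleton_of_mem (show l ∈ pencil A from hAl),
      ncard_pencil] at hcard
    omega
  -- A tangent at `u` meets `l` outside `S`.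
  obtain ⟨m, hm⟩ : {m : Line F | IsTangentAt S u m}.Nonempty := by
    rw [← Set.ncard_pos, ht u huS]
    exact h0
  have hml : m ≠ l := fun h => hul (h ▸ hm.mem.2)
  obtain ⟨h1, h2⟩ := Configuration.HasPoints.mkPoint_ax (P := Point F) (L := Line F) hml
  refine ⟨_, h2, fun hS => hul ?_⟩
  rw [← IsTangentAt.eq hm hS h1]
  exact h2

/-- Every tangent at a point of `S ∩ l` contains a point of high index when `S ∩ l` is large. -/
theorem exists_lt_tangentIndex (hl : 2 ≤ (S ∩ Line.points l).ncard)
    (ht : ∀ P ∈ S ∩ Line.points l, {m : Line F | IsTangentAt S P m}.ncard = t)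
    (hk : Nat.card F * (t - 1) + t < (S ∩ Line.points l).ncard * t) {m : Line F}
    (hm : m ∈ tangentsAlong S l) : ∃ Q, Q ∈ m ∧ Q ∉ l ∧ t < tangentIndex S l Q := by
  classical
  have := Fintype.ofFinite (Point F)
  -- Otherwise each of the `q` points of `m` other than `P` lies on at most `t - 1` further
  -- tangents, so `k t ≤ t + q (t - 1)`.
  by_contra! hsmall
  obtain ⟨P, ⟨hPS, hPl⟩, hmP⟩ := hm
  have hml : m ≠ l := fun h => not_isTangentAt hl P (h ▸ hmP)
  have hsub : tangentsAlong S l ⊆ {m' | IsTangentAt S P m'} ∪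
      (((Line.points m \ {P}).toFinset.biUnion fun Q =>
        ((tangentsAlong S l ∩ pencil Q) \ {m}).toFinset : Finset (Line F)) : Set (Line F)) := by
    rintro m' ⟨P', ⟨hPS', hPl'⟩, hm'⟩
    by_cases hPP : P' = P
    · subst hPP
      exact Or.inl hm'
    · right
      have hmm : m' ≠ m := by
        rintro rfl
        exact hPP (IsTangentAt.eq hmP hm'.mem.1 hm'.mem.2)
      obtain ⟨h1, h2⟩ := Configuration.HasPoints.mkPoint_ax (P := Point F) (L := Line F) hmm
      simp only [Finset.coe_biUnion, Set.coe_toFinset, Set.mem_iUnion]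
      refine ⟨_, ⟨h2, fun hP => ?_⟩, ⟨⟨P', ⟨hPS', hPl'⟩, hm'⟩, h1⟩, hmm⟩
      rw [Set.mem_singleton_iff] at hP
      rw [hP] at h1
      exact hPP (IsTangentAt.eq hm' hPS h1).symm
  have hcard := (Set.ncard_le_ncard hsub).trans (Set.ncard_union_le _ _)
  rw [ncard_tangentsAlong ht, ht P ⟨hPS, hPl⟩, Set.ncard_coe_finset] at hcard
  have hbi := Finset.card_biUnion_le_card_mul (Line.points m \ {P}).toFinset
    (fun Q => ((tangentsAlong S l ∩ pencil Q) \ {m}).toFinset) (t - 1) fun Q hQ => by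
      rw [Set.mem_toFinset] at hQ
      have hQl : Q ∉ l := fun hQl =>
        hml (line_unique hQ.2 hQ.1 hmP.mem.2 hQl hPl)
      rw [← Set.ncard_eq_toFinset_card', Set.ncard_sdiff_singleton_of_mem
        (show m ∈ tangentsAlong S l ∩ pencil Q from ⟨⟨P, ⟨hPS, hPl⟩, hmP⟩, hQ.1⟩)]
      exact Nat.sub_le_sub_right (hsmall Q hQ.1 hQl) 1
  rw [← Set.ncard_eq_toFinset_card', Set.ncard_sdiff_singleton_of_mem
    (show P ∈ Line.points m from hmP.mem.2), ncard_points, Nat.add_sub_cancel] at hbi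
  omega

/-- Bonferroni's inequality for the pencils of the points of `C`. -/
theorem sum_ncard_inter_pencil_le (T : Set (Line F)) (C : Finset (Point F)) :
    ∑ Q ∈ C, (T ∩ pencil Q).ncard ≤ T.ncard + C.card.choose 2 := by
  classical
  suffices h : ∑ Q ∈ C, (T ∩ pencil Q).ncard ≤
      {m ∈ T | ∃ Q ∈ C, Q ∈ m}.ncard + C.card.choose 2 from
    h.trans (Nat.add_le_add_right (Set.ncard_le_ncard fun m hm => hm.1) _)
  induction C using Finset.induction_on with
  | empty => simp
  | insert Q C hQ ih =>
    have hunion : {m ∈ T | ∃ R ∈ insert Q C, R ∈ m} =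
        (T ∩ pencil Q) ∪ {m ∈ T | ∃ R ∈ C, R ∈ m} := by
      ext m
      simp only [Finset.exists_mem_insert, Set.mem_union]
      exact ⟨fun ⟨h, h'⟩ => h'.elim (fun h' => Or.inl ⟨h, h'⟩) fun h' => Or.inr ⟨h, h'⟩,
        fun h => h.elim (fun h => ⟨h.1, Or.inl h.2⟩) fun h => ⟨h.1, Or.inr h.2⟩⟩
    have hinter : ((T ∩ pencil Q) ∩ {m ∈ T | ∃ R ∈ C, R ∈ m}).ncard ≤ C.card := by
      have hex : ∀ m ∈ (T ∩ pencil Q) ∩ {m ∈ T | ∃ R ∈ C, R ∈ m}, ∃ R ∈ C, R ∈ m :=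
        fun m hm => hm.2.2
      choose! f hfC hfm using hex
      rw [← Set.ncard_coe_finset]
      refine Set.ncard_le_ncard_of_injOn f hfC fun m hm m' hm' hmm => ?_
      have hne : Q ≠ f m := fun h => hQ (h ▸ hfC m hm)
      refine line_unique hne hm.1.2 (hfm m hm) hm'.1.2 ?_
      rw [hmm]
      exact hfm m' hm'
    have hadd := Set.ncard_union_add_ncard_inter (T ∩ pencil Q) {m ∈ T | ∃ R ∈ C, R ∈ m}
    have hchoose : (C.card + 1).choose 2 = C.card + C.card.choose 2 := by
      rw [Nat.choose_succ_succ, Nat.choose_one_right]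
    rw [Finset.sum_insert hQ, Finset.card_insert_of_notMem hQ, hunion, hchoose]
    omega

/-- If every line of `T` passes through a point of index at least `D`, and `n + 1` such
points would carry too many lines, then `T` belongs to `n` pencils. -/
theorem belongToPencils_of_index {T : Set (Line F)} {n D : ℕ} (hn : n ≤ Nat.card F)
    (hT : ∀ m ∈ T, ∃ Q, Q ∈ m ∧ D ≤ (T ∩ pencil Q).ncard)
    (hD : T.ncard + (n + 1).choose 2 < (n + 1) * D) : BelongToPencils n T := by
  classical
  have := Fintype.ofFinite (Point F)
  let B : Finset (Point F) := Finset.univ.filter fun Q => D ≤ (T ∩ pencil Q).ncard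
  have hB : B.card ≤ n := by
    by_contra! hlt
    obtain ⟨C, hCB, hC⟩ := Finset.exists_subset_card_eq (show n + 1 ≤ B.card from hlt)
    have h1 := sum_ncard_inter_pencil_le T C
    have h2 := Finset.card_nsmul_le_sum C (fun Q => (T ∩ pencil Q).ncard) D fun Q hQ =>
      (Finset.mem_filter.mp (hCB hQ)).2
    rw [hC] at h1 h2
    rw [smul_eq_mul] at h2
    omega
  have hcard : n ≤ Fintype.card (Point F) := by
    rw [← Nat.card_eq_fintype_card,
      Projectivization.card_of_finrank F (Fin 3 → F) (n := 3) (by simp)]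
    simp only [Finset.sum_range_succ, Finset.sum_range_zero, pow_zero, pow_one]
    omega
  -- Arbitrary points pad `B` to exactly `n` carriers.
  obtain ⟨Cs, hBC, -, hCs⟩ := Finset.exists_subsuperset_card_eq (Finset.subset_univ B) hB hcard
  refine ⟨Cs, hCs, fun m hm => ?_⟩
  obtain ⟨Q, hQm, hQ⟩ := hT m hm
  exact ⟨Q, hBC (Finset.mem_filter.mpr ⟨Finset.mem_univ Q, hQ⟩), hQm⟩

/-- An index larger than `t` is at least `k + q - t - n`, where `k` and `n` are the numbers of
points of `S` on and off `l`. -/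
theorem le_tangentIndex (h0 : 0 < t) (htq : t < Nat.card F)
    (hl : 2 ≤ (S ∩ Line.points l).ncard)
    (ht : ∀ P ∈ S, {m : Line F | IsTangentAt S P m}.ncard = t)
    (hn : ((S \ Line.points l).ncard - Nat.card F + t + 1 : ℤ) * (t + 1) <
      (S ∩ Line.points l).ncard)
    {Q : Point F} (hQl : Q ∉ l) (hQ : t < tangentIndex S l Q) :
    ((S ∩ Line.points l).ncard + Nat.card F - t - (S \ Line.points l).ncard : ℤ) ≤
      tangentIndex S l Q := by
  obtain ⟨P₀, hP₀l, hP₀S⟩ := exists_mem_notMem h0 htq hl ht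
  have hquad := tangentIndex_quadratic hl (fun P hP => (ht P hP.1).le) hP₀l hP₀S hQl
  by_contra! hlt
  have h1 : (0 : ℤ) ≤ tangentIndex S l Q - t - 1 := by omega
  -- The quadratic `x² - (k + q - n) x + k t` takes equal values at `t + 1` and `k + q - n - t - 1`,
  -- negative by `hn`, so it is negative between them.
  nlinarith [mul_nonneg h1 (sub_nonneg.mpr (Int.add_one_le_iff.mpr hlt))]

end Counting

end PG2

/-! ### The main theorem -/

theorem corollary3p7 {F : Type*} [Field F] [Finite F] (q t k : ℕ) (hF : Nat.card F = q)
    (hq : 7 ≤ q) (ht1 : 1 < t) (htq : (t : ℝ) < Real.sqrt q)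
    (S : Set (PG2.Point F)) (hS : PG2.IsSemiarc t S)
    (l : PG2.Line F) (hl : PG2.IsSecant k S l)
    (hk : (q : ℝ) - (q : ℝ) / (t : ℝ) + 1 < (k : ℝ)) :
    (PG2.tangentsAlong S l).ncard = k * t ∧
    ((S.ncard : ℝ) < ((q : ℝ) - t + k) + (k : ℝ) / ((t : ℝ) + 1) - 1 →
      PG2.BelongToPencils (t + 1) (PG2.tangentsAlong S l)) ∧
    ((S.ncard : ℝ) < ((q : ℝ) - t + k) + (k : ℝ) / ((t : ℝ) + 1) - (t : ℝ) / 2 →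
      PG2.BelongToPencils t (PG2.tangentsAlong S l)) := by
  subst hF
  have ht0 : (0 : ℝ) < t := by positivity
  have ht1' : (2 : ℤ) ≤ t := by exact_mod_cast ht1
  have htq' : t ^ 2 < Nat.card F := by
    have := (Real.lt_sqrt ht0.le).mp htq
    exact_mod_cast this
  have htq'' : (t : ℤ) ^ 2 + 1 ≤ Nat.card F := by exact_mod_cast htq'
  have hcardt : t + 1 ≤ Nat.card F := by nlinarith
  have hkt : (Nat.card F : ℤ) * (t - 1) + t < k * t := by
    have : (Nat.card F : ℝ) * (t - 1) + t < k * t := by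
      have h := mul_lt_mul_of_pos_right hk ht0
      rw [add_mul, sub_mul, div_mul_cancel₀ _ ht0.ne'] at h
      linarith
    exact_mod_cast this
  have hkt' : Nat.card F * (t - 1) + t < k * t := by
    zify [ht1.le]
    exact hkt
  have hk2 : 2 ≤ k := by
    by_contra! hlt
    have : k * t ≤ 1 * t := Nat.mul_le_mul_right t (by omega)
    omega
  have hsec : (S ∩ PG2.Line.points l).ncard = k := by
    rw [Set.ncard, hl, ENat.toNat_natCast]
  have htan : ∀ P ∈ S, {m : PG2.Line F | PG2.IsTangentAt S P m}.ncard = t := fun P hP => by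
    rw [Set.ncard, hS.2 P hP, ENat.toNat_natCast]
  have hl2 : 2 ≤ (S ∩ PG2.Line.points l).ncard := hsec.symm ▸ hk2
  have hT : (PG2.tangentsAlong S l).ncard = k * t := by
    rw [PG2.ncard_tangentsAlong fun P hP => htan P hP.1, hsec]
  have hcard : (S.ncard : ℝ) = k + (S \ PG2.Line.points l).ncard := by
    rw [← hsec]
    exact_mod_cast (Set.ncard_inter_add_ncard_sdiff_eq_ncard S (PG2.Line.points l)).symm
  set n := (S \ PG2.Line.points l).ncard with hn
  have hpencils : ∀ N : ℕ, N ≤ Nat.card F → ((n : ℤ) - Nat.card F + t + 1) * (t + 1) < k →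
      k * t + ((N + 1).choose 2 : ℤ) < (N + 1) * (k + Nat.card F - t - n) →
      PG2.BelongToPencils N (PG2.tangentsAlong S l) := by
    intro N hN hsmall hlarge
    have hD : (0 : ℤ) ≤ k + Nat.card F - t - n := by
      by_contra! hneg
      nlinarith [mul_nonneg (Int.natCast_nonneg k) (Int.natCast_nonneg t)]
    refine PG2.belongToPencils_of_index (D := (k + Nat.card F - t - n : ℤ).toNat) hN
      (fun m hm => ?_) ?_
    · obtain ⟨Q, hQm, hQl, hQ⟩ := PG2.exists_lt_tangentIndex hl2 (fun P hP => htan P hP.1)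
        (by rw [hsec]; exact hkt') hm
      refine ⟨Q, hQm, Int.toNat_le.mpr ?_⟩
      have := PG2.le_tangentIndex (by omega) (by omega) hl2 htan (by rw [hsec, ← hn]; exact hsmall)
        hQl hQ
      rw [hsec, ← hn] at this
      exact this
    · zify
      rw [hT, Int.toNat_of_nonneg hD]
      push_cast
      exact hlarge
  have hchoose : ∀ N : ℕ, 2 * ((N + 1).choose 2 : ℤ) = (N + 1) * N := by
    intro N
    have h : (N + 1).choose 2 * 2 = (N + 1) * N := by
      rw [Nat.choose_two_right, Nat.add_sub_cancel]
      exact Nat.div_mul_cancel (by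
        rw [mul_comm]; exact (Nat.even_mul_succ_self N).two_dvd)
    rw [mul_comm]
    exact_mod_cast h
  refine ⟨hT, fun h => ?_, fun h => ?_⟩
  · have hlt : ((n : ℤ) - Nat.card F + t + 1) * (t + 1) < k := by
      have : ((n : ℝ) - Nat.card F + t + 1) * (t + 1) < k := by
        rw [← lt_div_iff₀ (by positivity)]
        linarith
      exact_mod_cast this
    refine hpencils (t + 1) hcardt hlt ?_
    have hc := hchoose (t + 1)
    push_cast at hc ⊢
    have hq' : ((t : ℤ) ^ 2 + 1) * (t - 1) ≤ Nat.card F * (t - 1) :=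
      mul_le_mul_of_nonneg_right htq'' (by omega)
    -- Up to the constant `2`, this is the slack in `hkt2` once `k t` is bounded below by `(t² +
    -- 1)(t - 1) + t + 1`.
    have hcube : (0 : ℤ) ≤ t * ((t - 2) ^ 2 + 1) := by positivity
    have hkt2 : ((t : ℤ) + 2) * (t ^ 2 - 1) ≤ 2 * (k * t) := by nlinarith
    have hD : (k : ℤ) * t + t + 1 < (t + 1) * (k + Nat.card F - t - n) := by linarith
    have hD2 := mul_lt_mul_of_pos_left hD (show (0 : ℤ) < 2 * (t + 2) by omega)
    refine lt_of_mul_lt_mul_left ?_ (show (0 : ℤ) ≤ 2 * (t + 1) by omega)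
    linear_combination hD2 + hkt2 + (t + 1) * hc
  -- Rearranged, this is twice the Bonferroni condition for `N = t`; it also implies the smallness
  -- condition on `n`, as `t ≥ 2`.
  · have hlt : (2 * ((n : ℤ) - Nat.card F + t) + t) * (t + 1) < 2 * k := by
      have : (2 * ((n : ℝ) - Nat.card F + t) + t) * (t + 1) < 2 * k := by
        rw [← lt_div_iff₀ (by positivity), mul_div_assoc]
        linarith
      exact_mod_cast this
    refine hpencils t (by omega) ?_ ?_
    · nlinarith
    · have hc := hchoose t
      nlinarith
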